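/- Let $L$ be a countable first-order language, consisting of relation symbols, constant symbols and function symbols of finite arities, and let $\mathcal{M}$ be a countably infinite $L$-structure. Let $S_L$ be the set of all $L$-structures with underlying set $\mathbb{N}$, equipped with the $\sigma$-algebra generated by the sets $\{\mathcal{N}\in S_L : R^{\mathcal{N}}(n_1,\dots,n_j)\}$, $\{\mathcal{N}\in S_L : c^{\mathcal{N}}=\ell\}$ and $\{\mathcal{N}\in S_L : f^{\mathcal{N}}(n_1,\dots,n_k)=\ell\}$, where $R$ ranges over the relation symbols of $L$ (with $j$ the arity of $R$), $c$ over the constant symbols, $f$ over the function symbols (with $k$ the arity of $f$), and $n_1,n_2,\dots,\ell$ over $\mathbb{N}$. The group $S_\infty$ of all permutations of $\mathbb{N}$ acts on $S_L$ by transport of structure: for $g \in S_\infty$ and $\mathcal{N} \in S_L$, $g\cdot\mathcal{N}$ is the unique structure in $S_L$ such that $g$ is an isomorphism from $\mathcal{N}$ onto $g\cdot\mathcal{N}$. Then the following are equivalent. (1) There is a probability measure $\mu$ on $S_L$ that is invariant under $S_\infty$, i.e. $\mu(X)=\mu(g\cdot X)$ for every measurable $X\subseteq S_L$ and every $g\in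 S_\infty$, and that is concentrated on the isomorphism class of $\mathcal{M}$, i.e. $\mu(\{\mathcal{N}\in S_L : \mathcal{N}\cong\mathcal{M}\})=1$. (2) $\mathcal{M}$ has trivial group-theoretic definable closure: for every $n \ge 0$ and every tuple $\mathbf{a}=(a_1,\dots,a_n)$ of elements of $\mathcal{M}$, $\operatorname{dcl}_{\mathcal{M}}(\mathbf{a})=\{a_1,\dots,a_n\}$, where $\operatorname{dcl}_{\mathcal{M}}(\mathbf{a})$ is the set of all $b\in\mathcal{M}$ that are fixed by every automorphism of $\mathcal{M}$ fixing each of $a_1,\dots,a_n$. -/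

import Mathlib

open FirstOrder MeasureTheory

universe u v w

namespace InvariantMeasures

/-- The space of `L`-structures with underlying set `ℕ`. Constant symbols are the function symbols
of arity `0`. -/
abbrev StructureSpace (L : FirstOrder.Language.{u, v}) : Type (max u v) := L.Structure ℕ

/-- The set of structures on `ℕ` in which the relation `R` holds of the tuple `x`. -/
def relSet (L : FirstOrder.Language.{u, v}) {n : ℕ} (R : L.Relations n) (x : Fin n → ℕ) :
    Set (StructureSpace L) :=
  {N | N.RelMap R x}

/-- The set of structures on `ℕ` in which the function `f` (a constant if `n = 0`) takes the value
`l` at the tuple `x`. -/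
def funSet (L : FirstOrder.Language.{u, v}) {n : ℕ} (f : L.Functions n) (x : Fin n → ℕ) (l : ℕ) :
    Set (StructureSpace L) :=
  {N | N.funMap f x = l}

/-- The `σ`-algebra on the space of structures generated by the subbasic open sets. -/
instance structureSpaceMeasurableSpace (L : FirstOrder.Language.{u, v}) :
    MeasurableSpace (StructureSpace L) :=
  MeasurableSpace.generateFrom
    ({X | ∃ (n : ℕ) (R : L.Relations n) (x : Fin n → ℕ), X = relSet L R x} ∪
      {X | ∃ (n : ℕ) (f : L.Functions n) (x : Fin n → ℕ) (l : ℕ), X = funSet L f x l})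

/-- The logic action of the group of permutations of `ℕ`: `logicAction L g N` is the structure on
`ℕ` obtained by transporting `N` along `g`, so that `g` is an isomorphism from `N` onto it. -/
def logicAction (L : FirstOrder.Language.{u, v}) (g : Equiv.Perm ℕ) (N : StructureSpace L) :
    StructureSpace L :=
  letI := N
  g.inducedStructure

/-- Invariance of a measure on the space of structures under the logic action. -/
def IsInvariant (L : FirstOrder.Language.{u, v}) (μ : Measure (StructureSpace L)) : Prop :=
  ∀ (g : Equiv.Perm ℕ) (X : Set (StructureSpace L)), MeasurableSet X →
    μ X = μ (logicAction L g '' X)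

/-- The set of structures on `ℕ` that are isomorphic to `M`. -/
def isoClass (L : FirstOrder.Language.{u, v}) (M : Type w) [L.Structure M] : Set (StructureSpace L) :=
  {N | letI := N; Nonempty (ℕ ≃[L] M)}

/-- The group-theoretic definable closure of a tuple `a`: the elements fixed by all automorphisms
that fix `a` pointwise. -/
def dcl (L : FirstOrder.Language.{u, v}) {M : Type w} [L.Structure M] {n : ℕ} (a : Fin n → M) : Set M :=
  {b | ∀ g : M ≃[L] M, (∀ i, g (a i) = a i) → g b = b}

end InvariantMeasures

/-! Necessity. Let `b` lie in the definable closure of `a` but not in `a`. In a random copy of `M`,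
some labels `x` for `a` and `y` for `b`, with `y` outside `x`, occur together with positive outer
measure. Permutations fixing `x` carry `y` to any other label outside `x`, so by invariance each of
these infinitely many events is at least as likely. But the labels of `a` determine that of `b`, so
the events are disjoint, which is impossible in a probability space. The events are only analytic,
and Luzin separation supplies disjoint measurable hulls (`exists_measurable_disjoint_markedClass`).

Sufficiency. With trivial definable closure, any point of a finite set has conjugates over the other
points outside that set (`exists_conjugate_notMem`). This allows a sequence of finite subsets of `M`
to grow by two kinds of steps: cloning a point, or adding new roots that realize extensions of
tuples already present (`CloneSystem`). Independent random paths start outside `M`, enter at roots,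
and may jump from a point to a clone of it. Once finitely many paths are inside `M` and pairwise
distinct, at most one of them jumps at each step, and an automorphism realizes the move. The orbit
of their positions is therefore constant from then on, and the late positions define a structure on
the set of paths. A back-and-forth argument shows that this structure is almost surely isomorphic to
`M` (`Generic.exists_equiv`, `ae_generic`). Its law is invariant because the paths are independent
and identically distributed. -/

namespace InvariantMeasures

/-! ### Copies of `M` on `ℕ` and marked isomorphism classes -/

section Transport

variable {L : FirstOrder.Language.{u, v}} {M : Type w} [L.Structure M]

/-- The structure on `ℕ` that makes `h : ℕ ≃ M` an isomorphism onto `M`. -/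
abbrev pullback (L : FirstOrder.Language.{u, v}) {M : Type w} [L.Structure M] (h : ℕ ≃ M) :
    StructureSpace L :=
  h.symm.inducedStructure

theorem pullback_mem_isoClass (h : ℕ ≃ M) : pullback L h ∈ isoClass L M := by
  let := pullback L h
  exact ⟨(Equiv.inducedStructureEquiv h.symm).symm⟩

theorem exists_pullback_of_mem_isoClass {N : StructureSpace L} (hN : N ∈ isoClass L M) :
    ∃ h : ℕ ≃ M, N = pullback L h := by
  let := N
  obtain ⟨e⟩ : Nonempty (ℕ ≃[L] M) := hN
  refine ⟨e.toEquiv, ?_⟩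
  apply FirstOrder.Language.Structure.ext
  · funext n f x
    change _ = e.symm (Language.Structure.funMap f (e ∘ x))
    rw [← e.map_fun, e.symm_apply_apply]
  · funext n R x
    exact propext (e.map_rel R x).symm

theorem logicAction_pullback (g : Equiv.Perm ℕ) (h : ℕ ≃ M) :
    logicAction L g (pullback L h) = pullback L (g.symm.trans h) :=
  rfl

theorem logicAction_logicAction_symm (g : Equiv.Perm ℕ) (N : StructureSpace L) :
    logicAction L g (logicAction L g.symm N) = N := by
  apply FirstOrder.Language.Structure.ext
  · funext n f x
    change g (g.symm (N.funMap f (g ∘ (g.symm ∘ x)))) = _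
    simp [← Function.comp_assoc]
  · funext n R x
    change N.RelMap R (g ∘ (g.symm ∘ x)) = _
    simp [← Function.comp_assoc]

/-- Two bijections that induce the same structure differ by an automorphism. -/
theorem exists_automorphism_of_pullback_eq {h h' : ℕ ≃ M} (e : pullback L h = pullback L h') :
    ∃ σ : M ≃[L] M, ∀ n, σ (h n) = h' n := by
  refine ⟨{ h.symm.trans h' with map_fun' := ?_, map_rel' := ?_ }, ?_⟩
  · intro n f x
    have := congrArg (fun N : StructureSpace L => h' (N.funMap f (h.symm ∘ x))) e
    simpa [← Function.comp_assoc, Function.comp_def] using this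
  · intro n R x
    have := congrArg (fun N : StructureSpace L => N.RelMap R (h.symm ∘ x)) e
    simpa [← Function.comp_assoc, Function.comp_def] using this.symm
  · intro n
    change h' (h.symm (h n)) = _
    simp

/-- The structures isomorphic to `M` by a map taking `x` to `a` and `y` to `b`. -/
def markedClass (L : FirstOrder.Language.{u, v}) {M : Type w} [L.Structure M] {n : ℕ}
    (a : Fin n → M) (b : M) (x : Fin n → ℕ) (y : ℕ) : Set (StructureSpace L) :=
  {N | ∃ h : ℕ ≃ M, N = pullback L h ∧ (∀ i, h (x i) = a i) ∧ h y = b}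

theorem logicAction_image_markedClass {n : ℕ} (a : Fin n → M) (b : M) (x : Fin n → ℕ) (y : ℕ)
    (g : Equiv.Perm ℕ) (hg : ∀ i, g (x i) = x i) :
    markedClass L a b x (g y) ⊆ logicAction L g '' markedClass L a b x y := by
  rintro _ ⟨h, rfl, hx, hy⟩
  refine ⟨pullback L (g.trans h), ⟨g.trans h, rfl, fun i => by simp [hg, hx], by simp [hy]⟩, ?_⟩
  rw [logicAction_pullback]
  congr 1
  ext i
  simp

/-- Two isomorphisms onto `M` from the same structure differ by an automorphism; if both send `x` to
`a`, it fixes `a` and hence `b`, so both pull `b` back to the same label. -/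
theorem disjoint_markedClass {n : ℕ} {a : Fin n → M} {b : M} (hb : b ∈ dcl L a) (x : Fin n → ℕ)
    {y y' : ℕ} (hy : y ≠ y') : Disjoint (markedClass L a b x y) (markedClass L a b x y') := by
  rw [Set.disjoint_left]
  rintro _ ⟨h, rfl, hx, hyb⟩ ⟨h', e, hx', hyb'⟩
  obtain ⟨σ, hσ⟩ := exists_automorphism_of_pullback_eq e
  have := hb σ (fun i => by rw [← hx, hσ, hx', hx])
  rw [← hyb, hσ, hyb, ← hyb'] at this
  exact hy (h'.injective this)

end Transport

/-! ### Analyticity, separation, and necessity of trivial definable closure -/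

section Coding

variable {L : FirstOrder.Language.{u, v}}

/-- The instances of relation and function symbols at tuples of natural numbers. -/
abbrev AtomIndex (L : FirstOrder.Language.{u, v}) :=
  (Σ n, L.Relations n × (Fin n → ℕ)) ⊕ (Σ n, L.Functions n × (Fin n → ℕ))

instance atomIndex_countable [Countable L.Symbols] : Countable (AtomIndex L) := by
  have h₁ : Countable (Σ n, L.Relations n) :=
    (Function.Injective.countable (f := fun r => (Sum.inr r : L.Symbols)) Sum.inr_injective)
  have h₂ : Countable (Σ n, L.Functions n) :=
    (Function.Injective.countable (f := fun r => (Sum.inl r : L.Symbols)) Sum.inl_injective)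
  have : ∀ n, Countable (L.Relations n) := fun n =>
    Function.Injective.countable (f := Sigma.mk (β := L.Relations) n) sigma_mk_injective
  have : ∀ n, Countable (L.Functions n) := fun n =>
    Function.Injective.countable (f := Sigma.mk (β := L.Functions) n) sigma_mk_injective
  infer_instance

theorem measurableSet_relSet {n : ℕ} (R : L.Relations n) (x : Fin n → ℕ) :
    MeasurableSet (relSet L R x) :=
  MeasurableSpace.measurableSet_generateFrom (Or.inl ⟨n, R, x, rfl⟩)

theorem measurableSet_funSet {n : ℕ} (f : L.Functions n) (x : Fin n → ℕ) (l : ℕ) :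
    MeasurableSet (funSet L f x l) :=
  MeasurableSpace.measurableSet_generateFrom (Or.inr ⟨n, f, x, l, rfl⟩)

theorem measurable_of_atoms {Ω : Type*} [MeasurableSpace Ω] {N : Ω → StructureSpace L}
    (hR : ∀ (n : ℕ) (R : L.Relations n) (x : Fin n → ℕ), MeasurableSet (N ⁻¹' relSet L R x))
    (hf : ∀ (n : ℕ) (f : L.Functions n) (x : Fin n → ℕ) (l : ℕ),
      MeasurableSet (N ⁻¹' funSet L f x l)) : Measurable N := by
  refine measurable_generateFrom ?_
  rintro _ (⟨n, R, x, rfl⟩ | ⟨n, f, x, l, rfl⟩)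
  · exact hR n R x
  · exact hf n f x l

theorem measurable_logicAction (g : Equiv.Perm ℕ) : Measurable (logicAction L g) := by
  refine measurable_of_atoms (fun n R x => measurableSet_relSet R (g.symm ∘ x))
    (fun n f x l => ?_)
  convert measurableSet_funSet f (g.symm ∘ x) (g.symm l) using 1
  ext N
  exact (Equiv.eq_symm_apply g).symm

open Classical in
/-- The table of all atomic facts of a structure on `ℕ`. -/
noncomputable def atomTable (N : StructureSpace L) : AtomIndex L → ℕ
  | Sum.inl ⟨_, R, x⟩ => if N.RelMap R x then 1 else 0
  | Sum.inr ⟨_, f, x⟩ => N.funMap f x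

theorem atomTable_injective : Function.Injective (atomTable (L := L)) := by
  intro N N' h
  apply FirstOrder.Language.Structure.ext
  · funext n f x
    exact congrFun h (Sum.inr ⟨n, f, x⟩)
  · funext n R x
    have := congrFun h (Sum.inl ⟨n, R, x⟩)
    simp only [atomTable] at this
    by_cases h₁ : N.RelMap R x <;> by_cases h₂ : N'.RelMap R x <;> simp_all

theorem measurable_atomTable : Measurable (atomTable (L := L)) := by
  rw [measurable_pi_iff]
  rintro (⟨n, R, x⟩ | ⟨n, f, x⟩)
  · exact Measurable.ite (measurableSet_relSet R x) measurable_const measurable_const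
  · exact measurable_to_countable' fun l => measurableSet_funSet f x l

variable {M : Type w} [L.Structure M]

open Classical in
/-- The table of the structure pulled back along `p.1`, when `p.2` is the inverse of `p.1`. -/
noncomputable def pullbackTable (L : FirstOrder.Language.{u, v}) {M : Type w} [L.Structure M]
    (p : (ℕ → M) × (M → ℕ)) : AtomIndex L → ℕ
  | Sum.inl ⟨_, R, x⟩ => if Language.Structure.RelMap R (p.1 ∘ x) then 1 else 0
  | Sum.inr ⟨_, f, x⟩ => p.2 (Language.Structure.funMap f (p.1 ∘ x))

theorem measurable_pullbackTable [Countable M] [MeasurableSpace M] [DiscreteMeasurableSpace M] :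
    Measurable (pullbackTable L (M := M)) := by
  have hcomp : ∀ (n : ℕ) (x : Fin n → ℕ),
      Measurable fun p : (ℕ → M) × (M → ℕ) => p.1 ∘ x := fun n x =>
    measurable_pi_iff.2 fun i => (measurable_pi_apply (x i)).comp measurable_fst
  rw [measurable_pi_iff]
  rintro (⟨n, R, x⟩ | ⟨n, f, x⟩)
  · refine Measurable.ite ?_ measurable_const measurable_const
    exact (hcomp n x) (MeasurableSet.of_discrete (s := {z : Fin n → M |
      Language.Structure.RelMap R z}))
  · have : Measurable fun q : M × (M → ℕ) => q.2 q.1 :=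
      measurable_from_prod_countable_right fun m => measurable_pi_apply m
    exact this.comp (((Measurable.of_discrete (f := fun z : Fin n → M =>
      (Language.Structure.funMap f z : M))).comp (hcomp n x)).prodMk measurable_snd)

theorem analyticSet_atomTable_image_markedClass [Countable L.Symbols] [Countable M] {n : ℕ}
    (a : Fin n → M) (b : M) (x : Fin n → ℕ) (y : ℕ) :
    AnalyticSet (atomTable '' markedClass L a b x y) := by
  let : MeasurableSpace M := ⊤
  have : DiscreteMeasurableSpace M := ⟨fun _ => trivial⟩
  have happ : ∀ i : ℕ, Measurable fun p : (ℕ → M) × (M → ℕ) => p.1 i := fun i =>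
    (measurable_pi_apply i).comp measurable_fst
  have happ' : ∀ m : M, Measurable fun p : (ℕ → M) × (M → ℕ) => p.2 m := fun m =>
    (measurable_pi_apply m).comp measurable_snd
  -- Carrying the inverse as a second coordinate makes bijectivity a Borel condition and the value
  -- of a function symbol a measurable expression.
  let D : Set ((ℕ → M) × (M → ℕ)) :=
    {p | (∀ i, p.2 (p.1 i) = i) ∧ (∀ m, p.1 (p.2 m) = m) ∧ (∀ i, p.1 (x i) = a i) ∧ p.1 y = b}
  have hev : Measurable fun q : M × (M → ℕ) => q.2 q.1 :=
    measurable_from_prod_countable_right fun m => measurable_pi_apply m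
  have hev' : Measurable fun q : ℕ × (ℕ → M) => q.2 q.1 :=
    measurable_from_prod_countable_right fun m => measurable_pi_apply m
  have hD : MeasurableSet D := by
    have e : D = (⋂ i, (fun p : (ℕ → M) × (M → ℕ) => p.2 (p.1 i)) ⁻¹' {i}) ∩
        ((⋂ m, (fun p : (ℕ → M) × (M → ℕ) => p.1 (p.2 m)) ⁻¹' {m}) ∩
        ((⋂ i, (fun p : (ℕ → M) × (M → ℕ) => p.1 (x i)) ⁻¹' {a i}) ∩
        (fun p : (ℕ → M) × (M → ℕ) => p.1 y) ⁻¹' {b})) := by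
      ext p
      simp [D]
    rw [e]
    refine .inter (.iInter fun i => ?_) (.inter (.iInter fun m => ?_) (.inter (.iInter fun i => ?_) ?_))
    · exact (hev.comp ((happ i).prodMk measurable_snd)) (.of_discrete)
    · exact (hev'.comp ((happ' m).prodMk measurable_fst)) (.of_discrete)
    · exact happ _ .of_discrete
    · exact happ _ .of_discrete
  have e : atomTable '' markedClass L a b x y = pullbackTable L '' D := by
    ext c
    constructor
    · rintro ⟨_, ⟨h, rfl, hx, hy⟩, rfl⟩
      refine ⟨(h, h.symm), ⟨by simp, by simp, hx, hy⟩, ?_⟩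
      funext i
      rcases i with ⟨n, R, z⟩ | ⟨n, f, z⟩ <;> rfl
    · rintro ⟨⟨h, h'⟩, ⟨h₁, h₂, hx, hy⟩, rfl⟩
      refine ⟨_, ⟨⟨h, h', h₁, h₂⟩, rfl, hx, hy⟩, ?_⟩
      funext i
      rcases i with ⟨n, R, z⟩ | ⟨n, f, z⟩ <;> rfl
  rw [e]
  exact hD.analyticSet_image measurable_pullbackTable

/-- Disjoint marked classes are contained in disjoint measurable sets. -/
theorem exists_measurable_disjoint_markedClass [Countable L.Symbols] [Countable M] {n : ℕ}
    {a : Fin n → M} {b : M} (hb : b ∈ dcl L a) (x : Fin n → ℕ) :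
    ∃ B : ℕ → Set (StructureSpace L), (∀ y, MeasurableSet (B y)) ∧
      (∀ y, markedClass L a b x y ⊆ B y) ∧ Pairwise (Function.onFun Disjoint B) := by
  have hsep : ∀ y y' : ℕ, ∃ D : Set (StructureSpace L), MeasurableSet D ∧
      (y ≠ y' → markedClass L a b x y ⊆ D ∧ Disjoint (markedClass L a b x y') D) := by
    intro y y'
    by_cases hy : y = y'
    · exact ⟨∅, .empty, fun h => absurd hy h⟩
    · obtain ⟨D, h₁, h₂, h₃⟩ := (analyticSet_atomTable_image_markedClass a b x y).measurablySeparable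
        (analyticSet_atomTable_image_markedClass a b x y')
        ((Set.disjoint_image_iff atomTable_injective).2 (disjoint_markedClass hb x hy))
      refine ⟨atomTable ⁻¹' D, measurable_atomTable h₃, fun _ => ⟨Set.image_subset_iff.1 h₁, ?_⟩⟩
      rw [Set.disjoint_left] at h₂ ⊢
      exact fun N hN => h₂ (Set.mem_image_of_mem _ hN)
  choose D hD hDs using hsep
  -- Removing `D y' y` from `D y y'` turns pairwise separation into disjointness of the whole
  -- family.
  refine ⟨fun y => ⋂ y', {N | y ≠ y' → N ∈ D y y' \ D y' y}, fun y => .iInter fun y' => ?_,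
    fun y N hN => ?_, fun y y' hy => ?_⟩
  · by_cases h : y = y'
    · simp [h]
    · simp only [ne_eq, h, not_false_eq_true, forall_const]
      exact (hD y y').diff (hD y' y)
  · exact Set.mem_iInter.2 fun y' h =>
      ⟨(hDs y y' h).1 hN, fun h' => Set.disjoint_left.1 (hDs y' y h.symm).2 hN h'⟩
  · refine Set.disjoint_left.2 fun N h₁ h₂ => ?_
    exact ((Set.mem_iInter.1 h₁ y') hy).2 ((Set.mem_iInter.1 h₂ y) hy.symm).1

/-- Passing to a measurable hull extends invariance, as an inequality of outer measures, to sets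
such as marked classes that are not known to be measurable. -/
theorem IsInvariant.measure_image_le {μ : Measure (StructureSpace L)} (hμ : IsInvariant L μ)
    (g : Equiv.Perm ℕ) (X : Set (StructureSpace L)) : μ (logicAction L g '' X) ≤ μ X :=
  calc μ (logicAction L g '' X) ≤ μ (logicAction L g '' toMeasurable μ X) :=
        measure_mono (Set.image_mono (subset_toMeasurable μ X))
    _ = μ X := by rw [← hμ g _ (measurableSet_toMeasurable μ X), measure_toMeasurable]

theorem dcl_subset_range_of_isInvariant [Countable L.Symbols] [Countable M]
    (μ : Measure (StructureSpace L)) [IsProbabilityMeasure μ] (hμ : IsInvariant L μ)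
    (hM : μ (isoClass L M) = 1) {n : ℕ} (a : Fin n → M) : dcl L a ⊆ Set.range a := by
  intro b hb
  by_contra hba
  have hcover : isoClass L M ⊆
      ⋃ (x : Fin n → ℕ) (y : ℕ) (_ : y ∉ Set.range x), markedClass L a b x y := by
    intro N hN
    obtain ⟨h, rfl⟩ := exists_pullback_of_mem_isoClass hN
    simp only [Set.mem_iUnion]
    refine ⟨h.symm ∘ a, h.symm b, ?_, h, rfl, by simp, by simp⟩
    rintro ⟨i, hi⟩
    exact hba ⟨i, h.symm.injective hi⟩
  obtain ⟨x, y, hy, hpos⟩ : ∃ (x : Fin n → ℕ) (y : ℕ), y ∉ Set.range x ∧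
      μ (markedClass L a b x y) ≠ 0 := by
    by_contra! H
    have h0 := measure_mono_null hcover (measure_iUnion_null fun x => measure_iUnion_null fun y =>
      measure_iUnion_null fun hy => H x y hy)
    simp [hM] at h0
  obtain ⟨B, hBm, hB, hBd⟩ := exists_measurable_disjoint_markedClass (L := L) hb x
  have hle : ∀ y', y' ∉ Set.range x → μ (markedClass L a b x y) ≤ μ (B y') := by
    intro y' hy'
    have hfix : ∀ i, Equiv.swap y' y (x i) = x i := fun i =>
      Equiv.swap_apply_of_ne_of_ne (fun h => hy' ⟨i, h⟩) (fun h => hy ⟨i, h⟩)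
    have := logicAction_image_markedClass (L := L) a b x y' (Equiv.swap y' y) hfix
    rw [Equiv.swap_apply_left] at this
    exact (measure_mono this).trans ((hμ.measure_image_le _ _).trans (measure_mono (hB y')))
  -- Only finitely many disjoint sets can have measure above a fixed positive bound, yet every label
  -- outside the finite range of `x` gives one.
  have hfin := Measure.finite_const_le_meas_of_disjoint_iUnion μ (pos_iff_ne_zero.2 hpos) hBm hBd
    (measure_ne_top _ _)
  exact (Set.finite_range x).infinite_compl (hfin.subset hle)

end Coding

/-! ### Trivial definable closure and the construction of clone systems -/

section Closure

variable {L : FirstOrder.Language.{u, v}} {M : Type w} [L.Structure M]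

theorem exists_automorphism_moving (hM : ∀ (n : ℕ) (a : Fin n → M), dcl L a = Set.range a)
    (A : Finset M) {b : M} (hb : b ∉ A) : ∃ g : M ≃[L] M, (∀ a ∈ A, g a = a) ∧ g b ≠ b := by
  by_contra! H
  have : b ∈ dcl L (fun i => (A.equivFin.symm i : M)) := by
    intro g hg
    refine H g fun a ha => ?_
    simpa using hg (A.equivFin ⟨a, ha⟩)
  rw [hM] at this
  obtain ⟨i, rfl⟩ := this
  exact hb (A.equivFin.symm i).2

/-- Under trivial definable closure, an element `j` of a finite set has a conjugate outside of the
set over the other elements. -/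
theorem exists_conjugate_notMem (hM : ∀ (n : ℕ) (a : Fin n → M), dcl L a = Set.range a)
    (E : Finset M) (j : M) :
    ∃ g : M ≃[L] M, g j ∉ E ∧ ∀ i ∈ E, i ≠ j → g i = i := by
  classical
  let O : Set M := {c | ∃ g : M ≃[L] M, (∀ i ∈ E, i ≠ j → g i = i) ∧ g j = c}
  have hO : O.Infinite := by
    intro hfin
    -- If the orbit `O` were finite, an automorphism could fix all of it except `j` and still move
    -- `j`; then `g j` lies in `O` and is itself fixed, against injectivity.
    obtain ⟨g, hg, hgj⟩ := exists_automorphism_moving hM ((E ∪ hfin.toFinset).erase j) (b := j)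
      (by simp)
    have hgE : ∀ i ∈ E, i ≠ j → g i = i := fun i hi hij => hg i (by simp [hi, hij])
    have : g (g j) = g j := hg _ (by simpa [hgj] using Or.inr ⟨g, hgE, rfl⟩)
    exact hgj (g.injective this)
  obtain ⟨_, ⟨g, hg, rfl⟩, hE⟩ := hO.exists_notMem_finset E
  exact ⟨g, hE, hg⟩

end Closure

/-- An increasing sequence of finite subsets of `M`. The points added at step `k` are the values of
`pick k`; they are clones of `j` if `parent k = some j`, and new roots if `parent k = none`. -/
structure CloneSystem (L : FirstOrder.Language.{u, v}) (M : Type w) [L.Structure M] where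
  /-- The points present before step `k`. -/
  points : ℕ → Finset M
  /-- The point cloned at step `k`, if any. -/
  parent : ℕ → Option M
  /-- An enumeration of the points added at step `k`. -/
  pick : ℕ → ℕ → M
  points_zero : points 0 = ∅
  mem_points_succ : ∀ k m, m ∈ points (k + 1) ↔ m ∈ points k ∨ ∃ i, pick k i = m
  pick_notMem : ∀ k i, pick k i ∉ points k
  parent_mem : ∀ k j, parent k = some j → j ∈ points k
  pick_conj : ∀ k j, parent k = some j → ∀ i, ∃ g : M ≃[L] M, g j = pick k i ∧
    ∀ m ∈ points k, m ≠ j → g m = m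
  -- Recurrent cloning gives two paths at the same point infinitely many chances to separate.
  frequently_parent : ∀ j K, j ∈ points K → ∀ K', ∃ k, K' ≤ k ∧ parent k = some j
  -- This is the extension property for the back step. As the parent is `none`, paths already inside
  -- `M` do not move meanwhile.
  frequently_witness : ∀ (A : Finset M) (b : M) (K : ℕ), ∃ k, K ≤ k ∧ parent k = none ∧
    ∀ g : M ≃[L] M, (∀ a ∈ A, g a ∈ points k) →
      ∃ g' : M ≃[L] M, (∀ a ∈ A, g' a = g a) ∧ g' b ∈ points (k + 1)

theorem exists_frequent_enumeration (T : Type*) [Countable T] [Nonempty T] :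
    ∃ τ : ℕ → T, ∀ t K, ∃ k, K ≤ k ∧ τ k = t := by
  obtain ⟨f, hf⟩ := exists_surjective_nat T
  refine ⟨fun k => f k.unpair.1, fun t K => ?_⟩
  obtain ⟨m, rfl⟩ := hf t
  exact ⟨Nat.pair m K, Nat.right_le_pair _ _, by simp⟩

section Construction

variable {L : FirstOrder.Language.{u, v}} {M : Type w} [L.Structure M]

theorem exists_finset_witness [Infinite M] (E A : Finset M) (b : M) :
    ∃ E' : Finset M, E ⊂ E' ∧ ∀ g : M ≃[L] M, (∀ a ∈ A, g a ∈ E) →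
      ∃ g' : M ≃[L] M, (∀ a ∈ A, g' a = g a) ∧ g' b ∈ E' := by
  classical
  -- There are only finitely many maps from `A` to `E`; one automorphism is chosen for each map that
  -- some automorphism induces.
  have hch : ∀ t : A → E, ∃ g' : M ≃[L] M,
      (∃ g : M ≃[L] M, ∀ a : A, g a = t a) → ∀ a : A, g' a = t a := by
    intro t
    by_cases h : ∃ g : M ≃[L] M, ∀ a : A, g a = t a
    · exact ⟨h.choose, fun _ => h.choose_spec⟩
    · exact ⟨Language.Equiv.refl L M, fun h' => absurd h' h⟩
  choose γ hγ using hch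
  -- The point `c` only makes the inclusion strict, so that the step has something to pick.
  obtain ⟨c, hc⟩ := Infinite.exists_notMem_finset E
  refine ⟨insert c (E ∪ Finset.univ.image fun t => γ t b), ?_, fun g hg => ?_⟩
  · refine Finset.ssubset_iff_subset_ne.2 ⟨fun m hm => by simp [hm], fun h => hc ?_⟩
    rw [h]
    simp
  · refine ⟨γ fun a => ⟨g a, hg a a.2⟩, fun a ha => ?_, by simp⟩
    exact hγ (fun a => ⟨g a, hg a a.2⟩) ⟨g, fun _ => rfl⟩ ⟨a, ha⟩

theorem nonempty_cloneSystem [Countable M] [Infinite M]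
    (hM : ∀ (n : ℕ) (a : Fin n → M), dcl L a = Set.range a) : Nonempty (CloneSystem L M) := by
  classical
  have hstep : ∀ (t : M ⊕ (Finset M × M)) (E : Finset M), ∃ (p : Option M) (E' : Finset M),
      E ⊂ E' ∧
      (∀ j, p = some j → j ∈ E) ∧
      (∀ j, p = some j → ∀ c ∈ E', c ∉ E → ∃ g : M ≃[L] M, g j = c ∧ ∀ m ∈ E, m ≠ j → g m = m) ∧
      (∀ j, t = Sum.inl j → j ∈ E → p = some j) ∧
      (∀ A b, t = Sum.inr (A, b) → p = none ∧ ∀ g : M ≃[L] M, (∀ a ∈ A, g a ∈ E) →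
        ∃ g' : M ≃[L] M, (∀ a ∈ A, g' a = g a) ∧ g' b ∈ E') := by
    rintro (j | ⟨A, b⟩) E
    · by_cases hj : j ∈ E
      · obtain ⟨g, hgE, hg⟩ := exists_conjugate_notMem hM E j
        refine ⟨some j, insert (g j) E, Finset.ssubset_insert hgE, ?_, ?_, ?_, ?_⟩
        · rintro _ ⟨rfl⟩
          exact hj
        · rintro _ ⟨rfl⟩ c hc hcE
          obtain rfl | hc := Finset.mem_insert.1 hc
          · exact ⟨g, rfl, hg⟩
          · exact absurd hc hcE
        · rintro _ ⟨rfl⟩ _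
          rfl
        · simp
      -- The point `j` is not yet present, so the step adds an arbitrary root as filler.
      · obtain ⟨c, hc⟩ := Infinite.exists_notMem_finset E
        refine ⟨none, insert c E, Finset.ssubset_insert hc, by simp, by simp, ?_, by simp⟩
        rintro _ ⟨rfl⟩ h
        exact absurd h hj
    · obtain ⟨E', hE, h⟩ := exists_finset_witness (L := L) E A b
      refine ⟨none, E', hE, by simp, by simp, by simp, ?_⟩
      rintro _ _ ⟨rfl⟩
      exact ⟨rfl, h⟩
  choose p next hlt hmem hconj hclone hwit using hstep
  have : Nonempty (M ⊕ (Finset M × M)) := (Infinite.nonempty M).map Sum.inl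
  obtain ⟨τ, hτ⟩ := exists_frequent_enumeration (M ⊕ (Finset M × M))
  let E : ℕ → Finset M := Nat.rec ∅ fun k e => next (τ k) e
  have hE : ∀ k, E (k + 1) = next (τ k) (E k) := fun _ => rfl
  have hEmono : Monotone E := monotone_nat_of_le_succ fun k => (hlt (τ k) (E k)).subset
  have hpick : ∀ k, ∃ f : ℕ → M, Set.range f = (E (k + 1) \ E k : Finset M) := by
    intro k
    have hne : ((E (k + 1) \ E k : Finset M) : Set M).Nonempty :=
      Finset.coe_nonempty.2 (Finset.sdiff_nonempty.2 (hlt (τ k) (E k)).2)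
    obtain ⟨f, hf⟩ := (Finset.countable_toSet _).exists_eq_range hne
    exact ⟨f, hf.symm⟩
  choose pick hpick using hpick
  have hpick' : ∀ k m, (∃ i, pick k i = m) ↔ m ∈ E (k + 1) ∧ m ∉ E k := by
    intro k m
    have := Set.ext_iff.1 (hpick k) m
    simpa using this
  refine ⟨⟨E, fun k => p (τ k) (E k), pick, rfl, fun k m => ?_, fun k i => ?_, fun k j => hmem _ _ j,
    fun k j hj i => ?_, fun j K hj K' => ?_, fun A b K => ?_⟩⟩
  · rw [hpick']
    have := @hEmono k (k + 1) (Nat.le_succ k) m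
    tauto
  · exact ((hpick' k _).1 ⟨i, rfl⟩).2
  · obtain ⟨h₁, h₂⟩ := (hpick' k _).1 ⟨i, rfl⟩
    exact hconj _ _ j hj _ h₁ h₂
  · obtain ⟨k, hk, e⟩ := hτ (Sum.inl j) (max K K')
    exact ⟨k, (le_max_right _ _).trans hk,
      hclone _ _ j e (hEmono ((le_max_left _ _).trans hk) hj)⟩
  · obtain ⟨k, hk, e⟩ := hτ (Sum.inr (A, b)) K
    exact ⟨k, hk, hwit _ _ A b e⟩

end Construction

/-- A back-and-forth argument for a family of finite partial bijections. -/
theorem exists_equiv_of_back_and_forth {α β : Type*} [Countable α] [Countable β]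
    (P : Finset (α × β) → Prop) (h₀ : P ∅)
    (forth : ∀ p, P p → ∀ a, ∃ b q, P q ∧ p ⊆ q ∧ (a, b) ∈ q)
    (back : ∀ p, P p → ∀ b, ∃ a q, P q ∧ p ⊆ q ∧ (a, b) ∈ q)
    (hfun : ∀ p, P p → ∀ a b b', (a, b) ∈ p → (a, b') ∈ p → b = b')
    (hinj : ∀ p, P p → ∀ a a' b, (a, b) ∈ p → (a', b) ∈ p → a = a') :
    ∃ h : α ≃ β, ∀ F : Finset α, ∃ p, P p ∧ ∀ a ∈ F, (a, h a) ∈ p := by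
  classical
  have step : ∀ (t : Option (α ⊕ β)) (p : {p // P p}), ∃ q : {p // P p}, p.1 ⊆ q.1 ∧
      (∀ a, t = some (Sum.inl a) → ∃ b, (a, b) ∈ q.1) ∧
      (∀ b, t = some (Sum.inr b) → ∃ a, (a, b) ∈ q.1) := by
    rintro (_ | a | b) ⟨p, hp⟩
    · exact ⟨⟨p, hp⟩, subset_rfl, by simp, by simp⟩
    · obtain ⟨b, q, hq, hpq, h⟩ := forth p hp a
      refine ⟨⟨q, hq⟩, hpq, ?_, by simp⟩
      rintro _ ⟨rfl⟩
      exact ⟨b, h⟩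
    · obtain ⟨a, q, hq, hpq, h⟩ := back p hp b
      refine ⟨⟨q, hq⟩, hpq, by simp, ?_⟩
      rintro _ ⟨rfl⟩
      exact ⟨a, h⟩
  choose next hsub hl hr using step
  obtain ⟨τ, hτ⟩ := exists_surjective_nat (Option (α ⊕ β))
  let s : ℕ → {p // P p} := Nat.rec ⟨∅, h₀⟩ fun k p => next (τ k) p
  have hmono : Monotone fun k => (s k).1 := monotone_nat_of_le_succ fun k => hsub (τ k) (s k)
  have htot : ∀ a, ∃ b k, (a, b) ∈ (s k).1 := by
    intro a
    obtain ⟨k, hk⟩ := hτ (some (Sum.inl a))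
    obtain ⟨b, hb⟩ := hl (τ k) (s k) a hk
    exact ⟨b, k + 1, hb⟩
  have hsurj : ∀ b, ∃ a k, (a, b) ∈ (s k).1 := by
    intro b
    obtain ⟨k, hk⟩ := hτ (some (Sum.inr b))
    obtain ⟨a, ha⟩ := hr (τ k) (s k) b hk
    exact ⟨a, k + 1, ha⟩
  choose f kf hf using htot
  choose g kg hg using hsurj
  refine ⟨⟨f, g, fun a => ?_, fun b => ?_⟩, fun F => ?_⟩
  · exact hinj _ (s (max (kf a) (kg (f a)))).2 _ _ (f a) (hmono (le_max_right _ _) (hg _))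
      (hmono (le_max_left _ _) (hf a))
  · exact hfun _ (s (max (kg b) (kf (g b)))).2 (g b) _ _ (hmono (le_max_right _ _) (hf _))
      (hmono (le_max_left _ _) (hg b))
  · exact ⟨_, (s (F.sup kf)).2, fun a ha => hmono (Finset.le_sup ha) (hf a)⟩

/-! ### Paths and the back-and-forth for generic families -/

namespace CloneSystem

variable {L : FirstOrder.Language.{u, v}} {M : Type w} [L.Structure M] (S : CloneSystem L M)

open Classical in
/-- The path through the clone system determined by a sequence of coins: starting outside of `M`,
at step `k` it moves from `parent k` to `pick k i` if the coin shows `i + 1`, and otherwise stays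
where it is. -/
noncomputable def path (c : ℕ → ℕ) : ℕ → Option M
  | 0 => none
  | k + 1 => if path c k = S.parent k ∧ c k ≠ 0 then some (S.pick k (c k - 1)) else path c k

theorem path_succ_of_jump {c : ℕ → ℕ} {k : ℕ} (h : S.path c k = S.parent k) (h' : c k ≠ 0) :
    S.path c (k + 1) = some (S.pick k (c k - 1)) := by
  rw [path, if_pos ⟨h, h'⟩]

theorem path_succ_of_ne {c : ℕ → ℕ} {k : ℕ} (h : S.path c k ≠ S.parent k) :
    S.path c (k + 1) = S.path c k := by
  rw [path, if_neg fun h' => h h'.1]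

theorem path_succ_of_zero {c : ℕ → ℕ} {k : ℕ} (h : c k = 0) :
    S.path c (k + 1) = S.path c k := by
  rw [path, if_neg fun h' => h'.2 h]

theorem mem_points_of_path {c : ℕ → ℕ} {k : ℕ} {m : M} (h : S.path c k = some m) :
    m ∈ S.points k := by
  induction k with
  | zero => simp [path] at h
  | succ k ih =>
    rw [S.mem_points_succ]
    rw [path] at h
    split_ifs at h
    · exact Or.inr ⟨_, Option.some_injective _ h⟩
    · exact Or.inl (ih h)

theorem path_congr {c d : ℕ → ℕ} {k : ℕ} (h : ∀ i < k, c i = d i) : S.path c k = S.path d k := by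
  induction k with
  | zero => rfl
  | succ k ih => rw [path, path, ih fun i hi => h i (by omega), h k (by omega)]

theorem path_ne_none_mono {c : ℕ → ℕ} {k k' : ℕ} (hk : k ≤ k') (h : S.path c k ≠ none) :
    S.path c k' ≠ none := by
  induction k', hk using Nat.le_induction with
  | base => exact h
  | succ n _ ih =>
    rw [path]
    split_ifs <;> simp_all

theorem path_ne_pick (c : ℕ → ℕ) (k i : ℕ) : S.path c k ≠ some (S.pick k i) := fun h =>
  S.pick_notMem k i (S.mem_points_of_path h)

/-- Paths at different positions cannot both be at the parent, and a jump lands on a point that no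
path has yet occupied; hence separated paths never meet again. -/
theorem path_ne_path_mono {c d : ℕ → ℕ} {k k' : ℕ} (hk : k ≤ k') (h : S.path c k ≠ S.path d k) :
    S.path c k' ≠ S.path d k' := by
  induction k', hk using Nat.le_induction with
  | base => exact h
  | succ n _ ih =>
    rw [path, path]
    split_ifs with h₁ h₂ h₂
    · exact absurd (h₁.1.trans h₂.1.symm) ih
    · exact (S.path_ne_pick d n _).symm
    · exact S.path_ne_pick c n _
    · exact ih

/-- The paths indexed by `F` are inside of `M` and pairwise distinct at time `k`. -/
def Settled (c : ℕ → ℕ → ℕ) (F : Finset ℕ) (k : ℕ) : Prop :=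
  ∀ i ∈ F, S.path (c i) k ≠ none ∧ ∀ j ∈ F, i ≠ j → S.path (c i) k ≠ S.path (c j) k

variable {S}

theorem Settled.mono {c : ℕ → ℕ → ℕ} {F : Finset ℕ} {k k' : ℕ} (h : S.Settled c F k)
    (hk : k ≤ k') : S.Settled c F k' := fun i hi =>
  ⟨S.path_ne_none_mono hk (h i hi).1, fun j hj hij => S.path_ne_path_mono hk ((h i hi).2 j hj hij)⟩

/-- At most one path of a settled family sits at the parent. If it jumps, the automorphism attached
to the clone moves it and fixes every other occupied point; otherwise the identity works. -/
theorem Settled.exists_automorphism_succ {c : ℕ → ℕ → ℕ} {F : Finset ℕ} {k : ℕ}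
    (h : S.Settled c F k) : ∃ g : M ≃[L] M, ∀ i ∈ F, ∀ m, S.path (c i) k = some m →
      S.path (c i) (k + 1) = some (g m) := by
  by_cases hj : ∃ i ∈ F, S.path (c i) k = S.parent k ∧ c i k ≠ 0
  · obtain ⟨i₀, hi₀, hp, hc⟩ := hj
    obtain ⟨j, hj⟩ := Option.ne_none_iff_exists'.1 (h i₀ hi₀).1
    obtain ⟨g, hgj, hg⟩ := S.pick_conj k j (hp.symm.trans hj) (c i₀ k - 1)
    refine ⟨g, fun i hi m hm => ?_⟩
    by_cases hii : i = i₀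
    · subst hii
      rw [S.path_succ_of_jump hp hc, ← hgj, Option.some_injective _ (hm.symm.trans hj)]
    · have hne : S.path (c i) k ≠ S.path (c i₀) k := (h i hi).2 i₀ hi₀ hii
      rw [S.path_succ_of_ne (hp ▸ hne), hm, hg m (S.mem_points_of_path hm)]
      rintro rfl
      exact hne (hm.trans hj.symm)
  · push Not at hj
    refine ⟨Language.Equiv.refl L M, fun i hi m hm => ?_⟩
    by_cases hp : S.path (c i) k = S.parent k
    · rw [S.path_succ_of_zero (hj i hi hp), hm]
      rfl
    · rw [S.path_succ_of_ne hp, hm]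
      rfl

theorem Settled.exists_automorphism {c : ℕ → ℕ → ℕ} {F : Finset ℕ} {k k' : ℕ}
    (h : S.Settled c F k) (hk : k ≤ k') : ∃ g : M ≃[L] M, ∀ i ∈ F, ∀ m,
      S.path (c i) k = some m → S.path (c i) k' = some (g m) := by
  induction k', hk using Nat.le_induction with
  | base => exact ⟨Language.Equiv.refl L M, fun i _ m hm => hm⟩
  | succ n hn ih =>
    obtain ⟨g, hg⟩ := ih
    obtain ⟨g', hg'⟩ := (h.mono hn).exists_automorphism_succ
    exact ⟨g'.comp g, fun i hi m hm => hg' i hi _ (hg i hi m hm)⟩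

variable (S)

/-- A sequence of coin sequences is generic if all its paths enter `M` and get separated from each
other, and every point is occupied at all times. -/
structure Generic (c : ℕ → ℕ → ℕ) : Prop where
  enters : ∀ n, ∃ k, S.path (c n) k ≠ none
  separates : ∀ m n, m ≠ n → ∃ k, S.path (c m) k ≠ S.path (c n) k
  hits : ∀ k, ∀ m ∈ S.points k, ∃ n, S.path (c n) k = some m

/-- The finite partial maps into `M` along which all late positions are conjugate to `M`. -/
def Good (c : ℕ → ℕ → ℕ) (p : Finset (ℕ × M)) : Prop :=
  ∀ᶠ k in Filter.atTop, ∃ g : M ≃[L] M, ∀ q ∈ p, S.path (c q.1) k = some (g q.2)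

variable {S}

theorem Generic.eventually_settled {c : ℕ → ℕ → ℕ} (hc : S.Generic c) (F : Finset ℕ) :
    ∀ᶠ k in Filter.atTop, S.Settled c F k := by
  refine (Filter.eventually_all_finset F).2 fun i _ => Filter.Eventually.and ?_
    ((Filter.eventually_all_finset F).2 fun j _ => ?_)
  · obtain ⟨K, hK⟩ := hc.enters i
    filter_upwards [Filter.eventually_ge_atTop K] with k hk using S.path_ne_none_mono hk hK
  · by_cases hij : i = j
    · simp [hij]
    · obtain ⟨K, hK⟩ := hc.separates i j hij
      filter_upwards [Filter.eventually_ge_atTop K] with k hk _ using S.path_ne_path_mono hk hK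

/-- The orbit of settled positions no longer changes, so a single time at which they are conjugate
to the prescribed points suffices. -/
theorem Settled.good {c : ℕ → ℕ → ℕ} {F : Finset ℕ} {k : ℕ} (h : S.Settled c F k)
    {p : Finset (ℕ × M)} (hp : ∀ q ∈ p, q.1 ∈ F) (g : M ≃[L] M)
    (hg : ∀ q ∈ p, S.path (c q.1) k = some (g q.2)) : S.Good c p := by
  filter_upwards [Filter.eventually_ge_atTop k] with k' hk
  obtain ⟨g', hg'⟩ := h.exists_automorphism hk
  exact ⟨g'.comp g, fun q hq => hg' q.1 (hp q hq) _ (hg q hq)⟩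

theorem Generic.forth {c : ℕ → ℕ → ℕ} (hc : S.Generic c) (p : Finset (ℕ × M)) (hp : S.Good c p)
    (n : ℕ) : ∃ m q, S.Good c q ∧ p ⊆ q ∧ (n, m) ∈ q := by
  classical
  obtain ⟨k, hk, g, hg⟩ := ((hc.eventually_settled (insert n (p.image Prod.fst))).and hp).exists
  obtain ⟨m, hm⟩ := Option.ne_none_iff_exists'.1 (hk n (by simp)).1
  refine ⟨g.symm m, insert (n, g.symm m) p, ?_, Finset.subset_insert _ _, by simp⟩
  refine hk.good (fun q hq => ?_) g fun q hq => ?_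
  · obtain rfl | hq := Finset.mem_insert.1 hq
    · simp
    · exact Finset.mem_insert_of_mem (Finset.mem_image_of_mem _ hq)
  · obtain rfl | hq := Finset.mem_insert.1 hq
    · simpa using hm
    · exact hg q hq

theorem Generic.back {c : ℕ → ℕ → ℕ} (hc : S.Generic c) (p : Finset (ℕ × M)) (hp : S.Good c p)
    (b : M) : ∃ n q, S.Good c q ∧ p ⊆ q ∧ (n, b) ∈ q := by
  classical
  by_cases hb : ∃ n, (n, b) ∈ p
  · obtain ⟨n, hn⟩ := hb
    exact ⟨n, p, hp, subset_rfl, hn⟩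
  obtain ⟨K, hK⟩ := Filter.eventually_atTop.1
    ((hc.eventually_settled (p.image Prod.fst)).and hp)
  obtain ⟨k, hk, hpar, hwit⟩ := S.frequently_witness (p.image Prod.snd) b K
  obtain ⟨hset, g, hg⟩ := hK k hk
  obtain ⟨g', hg', hb'⟩ := hwit g fun a ha => by
    obtain ⟨q, hq, rfl⟩ := Finset.mem_image.1 ha
    exact S.mem_points_of_path (hg q hq)
  -- The new path is whichever one occupies the witness `g' b`; it differs from the old ones because
  -- `b` is not yet a value of `p`.
  obtain ⟨n, hn⟩ := hc.hits (k + 1) _ hb'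
  have hold : ∀ q ∈ p, S.path (c q.1) (k + 1) = some (g' q.2) := fun q hq => by
    rw [S.path_succ_of_ne (by rw [hg q hq, hpar]; simp), hg q hq,
      hg' _ (Finset.mem_image_of_mem _ hq)]
  have hnew : ∀ q ∈ p, S.path (c n) (k + 1) ≠ S.path (c q.1) (k + 1) := fun q hq h => by
    rw [hn, hold q hq] at h
    exact hb ⟨q.1, by rw [g'.injective (Option.some_injective _ h)]; exact hq⟩
  have hset' : S.Settled c (insert n (p.image Prod.fst)) (k + 1) := by
    have h₁ := hset.mono (Nat.le_succ k)
    intro i hi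
    rcases Finset.mem_insert.1 hi with rfl | hi'
    · refine ⟨by simp [hn], fun j hj hij => ?_⟩
      rcases Finset.mem_insert.1 hj with rfl | hj
      · exact absurd rfl hij
      · obtain ⟨q, hq, rfl⟩ := Finset.mem_image.1 hj
        exact hnew q hq
    · refine ⟨(h₁ i hi').1, fun j hj hij => ?_⟩
      rcases Finset.mem_insert.1 hj with rfl | hj
      · obtain ⟨q, hq, rfl⟩ := Finset.mem_image.1 hi'
        exact (hnew q hq).symm
      · exact (h₁ i hi').2 j hj hij
  refine ⟨n, insert (n, b) p, ?_, Finset.subset_insert _ _, by simp⟩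
  refine hset'.good (fun q hq => ?_) g' fun q hq => ?_
  · obtain rfl | hq := Finset.mem_insert.1 hq
    · simp
    · exact Finset.mem_insert_of_mem (Finset.mem_image_of_mem _ hq)
  · obtain rfl | hq := Finset.mem_insert.1 hq
    · exact hn
    · exact hold q hq

theorem Generic.exists_equiv [Countable M] {c : ℕ → ℕ → ℕ} (hc : S.Generic c) :
    ∃ h : ℕ ≃ M, ∀ F : Finset ℕ, ∀ᶠ k in Filter.atTop,
      ∃ g : M ≃[L] M, ∀ i ∈ F, S.path (c i) k = some (g (h i)) := by
  obtain ⟨h, hh⟩ := exists_equiv_of_back_and_forth (S.Good c)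
    (Filter.Eventually.of_forall fun k => ⟨Language.Equiv.refl L M, by simp⟩) hc.forth hc.back
    (fun p hp a b b' hb hb' => by
      obtain ⟨k, g, hg⟩ := hp.exists
      exact g.injective (Option.some_injective _ ((hg _ hb).symm.trans (hg _ hb'))))
    (fun p hp a a' b ha ha' => by
      by_contra hne
      obtain ⟨K, hK⟩ := hc.separates a a' hne
      obtain ⟨k, ⟨g, hg⟩, hk⟩ := (hp.and (Filter.eventually_ge_atTop K)).exists
      exact S.path_ne_path_mono hk hK ((hg _ ha).trans (hg _ ha').symm))
  refine ⟨h, fun F => ?_⟩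
  obtain ⟨p, hp, hF⟩ := hh F
  filter_upwards [hp] with k ⟨g, hg⟩
  exact ⟨g, fun i hi => hg _ (hF i hi)⟩

end CloneSystem

/-! ### Infinite product measures -/

section InfiniteProduct

variable {X : Type*} [MeasurableSpace X] (ν : Measure X) [IsProbabilityMeasure ν]

/-- Any `n` of the infinitely many independent constraints already bound the measure by `q ^ n`. -/
theorem infinitePi_pi_eq_zero {S : Set ℕ} (hS : S.Infinite) {T : ℕ → Set X}
    (hT : ∀ k, MeasurableSet (T k)) {q : ENNReal} (hq : q < 1) (h : ∀ k ∈ S, ν (T k) ≤ q) :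
    Measure.infinitePi (fun _ : ℕ => ν) (S.pi T) = 0 := by
  have hle : ∀ n : ℕ, Measure.infinitePi (fun _ : ℕ => ν) (S.pi T) ≤ q ^ n := by
    intro n
    obtain ⟨F, hF, rfl⟩ := hS.exists_subset_card_eq n
    calc _ ≤ Measure.infinitePi (fun _ : ℕ => ν) ((F : Set ℕ).pi T) :=
          measure_mono (Set.pi_mono' (fun _ _ => subset_rfl) hF)
      _ = ∏ k ∈ F, ν (T k) := Measure.infinitePi_pi _ fun k _ => hT k
      _ ≤ ∏ _k ∈ F, q := Finset.prod_le_prod' fun k hk => h k (hF hk)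
      _ = q ^ F.card := by simp
  exact le_antisymm (ge_of_tendsto' (ENNReal.tendsto_pow_atTop_nhds_zero_of_lt_one hq) hle)
    zero_le

theorem measurePreserving_comp_perm (g : Equiv.Perm ℕ) :
    MeasurePreserving (fun ω : ℕ → X => ω ∘ g) (Measure.infinitePi fun _ : ℕ => ν)
      (Measure.infinitePi fun _ : ℕ => ν) := by
  have hm : Measurable fun ω : ℕ → X => ω ∘ g :=
    measurable_pi_iff.2 fun i => measurable_pi_apply (g i)
  refine ⟨hm, Measure.eq_infinitePi _ fun s t ht => ?_⟩
  rw [Measure.map_apply hm (.pi s.countable_toSet fun i _ => ht i)]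
  have e : (fun ω : ℕ → X => ω ∘ g) ⁻¹' (s : Set ℕ).pi t =
      ((s.map g.toEmbedding : Finset ℕ) : Set ℕ).pi fun i => t (g.symm i) := by
    ext ω
    simp only [Set.mem_preimage, Set.mem_pi, Finset.mem_coe, Finset.mem_map_equiv,
      Function.comp_apply]
    exact ⟨fun h i hi => by simpa using h _ hi, fun h i hi => by simpa using h (g i) (by simpa)⟩
  rw [e, Measure.infinitePi_pi _ fun i _ => ht _]
  simp

theorem infinitePi_map_pair {i j : ℕ} (hij : i ≠ j) :
    (Measure.infinitePi fun _ : ℕ => ν).map (fun ω => (ω i, ω j)) = ν.prod ν := by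
  have h := ProbabilityTheory.iIndepFun_infinitePi (P := fun _ : ℕ => ν) (X := fun _ x => x)
    fun _ => measurable_id
  rw [(ProbabilityTheory.indepFun_iff_map_prod_eq_prod_map_map
    (measurable_pi_apply i).aemeasurable (measurable_pi_apply j).aemeasurable).1
    (h.indepFun hij)]
  simp [Measure.infinitePi_map_eval]

end InfiniteProduct

/-- Full support gives every finite run of coins positive probability, so every point is reached
with positive probability. -/
theorem exists_fullSupport_measure_nat :
    ∃ ν : Measure ℕ, IsProbabilityMeasure ν ∧ ∀ n, ν {n} ≠ 0 := by
  let p : unitInterval := ⟨1 / 2, by norm_num, by norm_num⟩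
  have h0 : p ≠ 0 := fun h => by simpa [p] using congrArg Subtype.val h
  have h1 : p ≠ 1 := fun h => by simpa [p] using congrArg Subtype.val h
  refine ⟨ProbabilityTheory.geometricMeasure p, inferInstance, fun n h => ?_⟩
  exact (ProbabilityTheory.geometricMeasure_real_singleton_pos h0 h1 n).ne' (by
    rw [measureReal_def, h, ENNReal.toReal_zero])

theorem measurableSet_eventually_nat {Ω : Type*} [MeasurableSpace Ω] {p : ℕ → Ω → Prop}
    (hp : ∀ k, MeasurableSet {ω | p k ω}) : MeasurableSet {ω | ∀ᶠ k in Filter.atTop, p k ω} := by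
  have e : {ω | ∀ᶠ k in Filter.atTop, p k ω} = ⋃ K : ℕ, ⋂ k : ℕ, ⋂ _ : K ≤ k, {ω | p k ω} := by
    ext ω
    simp [Filter.eventually_atTop]
  rw [e]
  exact .iUnion fun K => .iInter fun k => .iInter fun _ => hp k

/-! ### Almost sure genericity and the limit structure -/

namespace CloneSystem

variable {L : FirstOrder.Language.{u, v}} {M : Type w} [L.Structure M] (S : CloneSystem L M)

theorem measurable_path [MeasurableSpace (Option M)] [DiscreteMeasurableSpace (Option M)]
    (k : ℕ) : Measurable fun c => S.path c k := by
  classical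
  induction k with
  | zero => exact measurable_const
  | succ k ih =>
    have hk : Measurable fun c : ℕ → ℕ => c k := measurable_pi_apply k
    refine Measurable.ite ?_ ?_ ih
    · exact (ih (.of_discrete (s := {S.parent k}))).inter (hk (.of_discrete (s := {n | n ≠ 0})))
    · exact (Measurable.of_discrete (f := fun n => some (S.pick k (n - 1)))).comp hk

/-- A path that never again met the parent would stay put, but every possible position, including
`none`, recurs as a parent. -/
theorem frequently_path_eq_parent (d : ℕ → ℕ) (K : ℕ) :
    ∃ k, K ≤ k ∧ S.path d k = S.parent k := by
  by_contra! H
  have hconst : ∀ k, K ≤ k → S.path d k = S.path d K := fun k hk => by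
    induction k, hk using Nat.le_induction with
    | base => rfl
    | succ n hn ih => rw [S.path_succ_of_ne (H n hn), ih]
  obtain ⟨k, hk, hp⟩ : ∃ k, K ≤ k ∧ S.parent k = S.path d K := by
    rcases h : S.path d K with _ | j
    · obtain ⟨k, hk, hp, -⟩ := S.frequently_witness ∅ (S.pick 0 0) K
      exact ⟨k, hk, hp⟩
    · obtain ⟨k, hk, hp⟩ := S.frequently_parent j K (S.mem_points_of_path h) K
      exact ⟨k, hk, hp⟩
  exact H k hk ((hconst k hk).trans hp.symm)

theorem infinite_path_eq_parent (d : ℕ → ℕ) : {k | S.path d k = S.parent k}.Infinite :=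
  Set.infinite_of_not_bddAbove fun ⟨B, hB⟩ => by
    obtain ⟨k, hk, h⟩ := S.frequently_path_eq_parent d (B + 1)
    exact absurd (hB h) (by omega)

theorem exists_path_eq {k : ℕ} {m : M} (hm : m ∈ S.points k) : ∃ c, S.path c k = some m := by
  induction k generalizing m with
  | zero => simp [S.points_zero] at hm
  | succ k ih =>
    have modify : ∀ (c : ℕ → ℕ) (n : ℕ), S.path (Function.update c k n) k = S.path c k :=
      fun c n => S.path_congr fun i hi => Function.update_of_ne hi.ne _ _
    obtain hm | ⟨i, rfl⟩ := (S.mem_points_succ k m).1 hm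
    · obtain ⟨c, hc⟩ := ih hm
      refine ⟨Function.update c k 0, ?_⟩
      rw [S.path_succ_of_zero (Function.update_self ..), modify, hc]
    · obtain ⟨c, hc⟩ : ∃ c, S.path c k = S.parent k := by
        rcases h : S.parent k with _ | j
        · refine ⟨0, ?_⟩
          have : ∀ n, S.path 0 n = none := fun n => by
            induction n with
            | zero => rfl
            | succ n ih => rw [S.path_succ_of_zero rfl, ih]
          exact this k
        · exact ih (S.parent_mem k j h)
      -- Coin `0` means staying, so the coin for `pick k i` is `i + 1`.
      refine ⟨Function.update c k (i + 1), ?_⟩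
      rw [S.path_succ_of_jump ((modify c _).trans hc) (by simp)]
      simp

variable (ν : Measure ℕ) [IsProbabilityMeasure ν]

theorem measure_path_eq_ne_zero (hν : ∀ n, ν {n} ≠ 0) {k : ℕ} {m : M} (hm : m ∈ S.points k) :
    Measure.infinitePi (fun _ : ℕ => ν) {c | S.path c k = some m} ≠ 0 := by
  obtain ⟨c₀, hc₀⟩ := S.exists_path_eq hm
  have hsub : ((Finset.range k : Finset ℕ) : Set ℕ).pi (fun i => {c₀ i}) ⊆
      {c | S.path c k = some m} := fun c hc => by
    refine Eq.trans (S.path_congr fun i hi => ?_) hc₀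
    exact hc i (by simpa using hi)
  intro h
  have h0 := measure_mono_null hsub h
  rw [Measure.infinitePi_pi _ fun i _ => MeasurableSet.of_discrete] at h0
  exact Finset.prod_ne_zero_iff.2 (fun i _ => hν (c₀ i)) h0

/-- At each of the infinitely many times when `d` is at the parent, agreement forces both coins to
be zero or both nonzero, since a jump lands on a new point. Each constraint has probability at most
`max (ν {0}) (ν {0}ᶜ) < 1`. -/
theorem measure_path_agree_eq_zero (hν : ∀ n, ν {n} ≠ 0) (d : ℕ → ℕ) :
    Measure.infinitePi (fun _ : ℕ => ν) {c | ∀ k, S.path c k = S.path d k} = 0 := by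
  have hlt : ∀ n, ν {n}ᶜ < 1 := fun n => by
    rw [prob_compl_eq_one_sub .of_discrete]
    exact ENNReal.sub_lt_self ENNReal.one_ne_top one_ne_zero (hν n)
  have h0 : ν {0} < 1 := (measure_mono (by simp)).trans_lt (hlt 1)
  refine measure_mono_null ?_ (infinitePi_pi_eq_zero ν (S.infinite_path_eq_parent d)
    (T := fun k => if d k = 0 then {0} else {0}ᶜ) (fun _ => .of_discrete)
    (max_lt h0 (hlt 0)) fun k _ => ?_)
  · intro c hc k hk
    have hk' := (hc k).trans hk
    have hs := hc (k + 1)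
    by_cases hd : d k = 0
    · simp only [hd, if_true, Set.mem_singleton_iff]
      by_contra hck
      rw [S.path_succ_of_jump hk' hck, S.path_succ_of_zero hd] at hs
      exact S.path_ne_pick d k _ hs.symm
    · simp only [hd, if_false, Set.mem_compl_iff, Set.mem_singleton_iff]
      intro hck
      rw [S.path_succ_of_jump hk hd, S.path_succ_of_zero hck] at hs
      exact S.path_ne_pick c k _ hs
  · split_ifs
    · exact le_max_left _ _
    · exact le_max_right _ _

theorem ae_generic [Countable M] (hν : ∀ n, ν {n} ≠ 0) :
    ∀ᵐ c ∂Measure.infinitePi (fun _ : ℕ => Measure.infinitePi fun _ : ℕ => ν), S.Generic c := by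
  let : MeasurableSpace (Option M) := ⊤
  have : DiscreteMeasurableSpace (Option M) := ⟨fun _ => trivial⟩
  set ρ := Measure.infinitePi fun _ : ℕ => ν
  have enters : ∀ᵐ c ∂Measure.infinitePi (fun _ : ℕ => ρ), ∀ n, ∃ k, S.path (c n) k ≠ none := by
    refine ae_all_iff.2 fun n => ?_
    have h1 : ∀ᵐ c ∂ρ, ∃ k, S.path c k ≠ none := by
      -- The zero coin sequence never enters `M`, so not entering means agreeing with its path
      -- forever.
      refine measure_mono_null ?_ (S.measure_path_agree_eq_zero ν hν 0)
      intro c hc k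
      have h2 : ∀ k, S.path 0 k = none := fun k => by
        induction k with
        | zero => rfl
        | succ n ih => rw [S.path_succ_of_zero rfl, ih]
      rw [h2]
      simpa using not_exists.1 hc k
    exact (measurePreserving_eval_infinitePi (fun _ : ℕ => ρ) n).quasiMeasurePreserving.ae h1
  have separates : ∀ᵐ c ∂Measure.infinitePi (fun _ : ℕ => ρ), ∀ m n, m ≠ n →
      ∃ k, S.path (c m) k ≠ S.path (c n) k := by
    refine ae_all_iff.2 fun m => ae_all_iff.2 fun n => ?_
    by_cases hmn : m = n
    · simp [hmn]
    have hmeas : MeasurableSet {q : (ℕ → ℕ) × (ℕ → ℕ) | ∀ k, S.path q.2 k = S.path q.1 k} := by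
      rw [Set.ofPred_forall]
      exact .iInter fun k => measurableSet_eq_fun ((S.measurable_path k).comp measurable_snd)
        ((S.measurable_path k).comp measurable_fst)
    have hnull : (ρ.prod ρ) {q | ∀ k, S.path q.2 k = S.path q.1 k} = 0 := by
      rw [Measure.prod_apply hmeas]
      exact (lintegral_congr fun d => S.measure_path_agree_eq_zero ν hν d).trans lintegral_zero
    rw [← infinitePi_map_pair ρ hmn, Measure.map_apply ((measurable_pi_apply m).prodMk
      (measurable_pi_apply n)) hmeas] at hnull
    refine measure_mono_null ?_ hnull
    intro c hc k
    by_contra h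
    exact hc fun _ => ⟨k, fun h' => h h'.symm⟩
  have hits : ∀ᵐ c ∂Measure.infinitePi (fun _ : ℕ => ρ), ∀ k, ∀ m, m ∈ S.points k →
      ∃ n, S.path (c n) k = some m := by
    refine ae_all_iff.2 fun k => ae_all_iff.2 fun m => ?_
    by_cases hm : m ∈ S.points k
    · have hms : MeasurableSet {c | S.path c k = some m} :=
        S.measurable_path k (.of_discrete (s := {some m}))
      have hlt : ρ {c | S.path c k = some m}ᶜ < 1 := by
        rw [prob_compl_eq_one_sub hms]
        exact ENNReal.sub_lt_self ENNReal.one_ne_top one_ne_zero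
          (S.measure_path_eq_ne_zero ν hν hm)
      refine measure_mono_null ?_ (infinitePi_pi_eq_zero ρ Set.infinite_univ
        (T := fun _ => {c | S.path c k = some m}ᶜ) (fun _ => hms.compl) hlt fun _ _ => le_rfl)
      intro c hc n _
      exact fun h => hc fun _ => ⟨n, h⟩
    · simp [hm]
  filter_upwards [enters, separates, hits] with c h₁ h₂ h₃ using ⟨h₁, h₂, h₃⟩

/-- The relation symbol `R` holds at the late positions of the paths `x`. -/
def EventuallyRel (c : ℕ → ℕ → ℕ) {n : ℕ} (R : L.Relations n) (x : Fin n → ℕ) : Prop :=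
  ∀ᶠ k in Filter.atTop, ∃ a : Fin n → M, (∀ i, S.path (c (x i)) k = some (a i)) ∧
    Language.Structure.RelMap R a

/-- The function symbol `f` maps the late positions of the paths `x` to those of the path `l`. -/
def EventuallyFun (c : ℕ → ℕ → ℕ) {n : ℕ} (f : L.Functions n) (x : Fin n → ℕ) (l : ℕ) : Prop :=
  ∀ᶠ k in Filter.atTop, ∃ a : Fin n → M, (∀ i, S.path (c (x i)) k = some (a i)) ∧
    S.path (c l) k = some (Language.Structure.funMap f a)

/-- The structure on the set of paths given by their late positions. -/
def IsLimit (c : ℕ → ℕ → ℕ) (N : StructureSpace L) : Prop :=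
  (∀ (n : ℕ) (R : L.Relations n) (x : Fin n → ℕ), N.RelMap R x ↔ S.EventuallyRel c R x) ∧
    ∀ (n : ℕ) (f : L.Functions n) (x : Fin n → ℕ) (l : ℕ),
      N.funMap f x = l ↔ S.EventuallyFun c f x l

variable {S}

/-- Late positions are images under automorphisms of the points `h i`, and automorphisms preserve
atomic facts. -/
theorem Generic.exists_isLimit [Countable M] {c : ℕ → ℕ → ℕ} (hc : S.Generic c) :
    ∃ h : ℕ ≃ M, S.IsLimit c (pullback L h) := by
  obtain ⟨h, hh⟩ := hc.exists_equiv
  refine ⟨h, fun n R x => ?_, fun n f x l => ?_⟩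
  · change Language.Structure.RelMap R (h ∘ x) ↔ _
    have hx := hh (Finset.univ.image x)
    constructor
    · intro H
      filter_upwards [hx] with k ⟨g, hg⟩
      exact ⟨g ∘ h ∘ x, fun i => hg _ (by simp), (g.map_rel R _).2 H⟩
    · intro H
      obtain ⟨k, ⟨g, hg⟩, a, ha, hR⟩ := (hx.and H).exists
      have : a = g ∘ h ∘ x := funext fun i =>
        Option.some_injective _ ((ha i).symm.trans (hg _ (by simp)))
      exact (g.map_rel R _).1 (this ▸ hR)
  · change h.symm (Language.Structure.funMap f (h ∘ x)) = l ↔ _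
    rw [Equiv.symm_apply_eq]
    have hx := hh (insert l (Finset.univ.image x))
    constructor
    · intro H
      filter_upwards [hx] with k ⟨g, hg⟩
      refine ⟨g ∘ h ∘ x, fun i => hg _ (by simp), ?_⟩
      rw [← g.map_fun, H]
      exact hg l (by simp)
    · intro H
      obtain ⟨k, ⟨g, hg⟩, a, ha, hf⟩ := (hx.and H).exists
      have : a = g ∘ h ∘ x := funext fun i =>
        Option.some_injective _ ((ha i).symm.trans (hg _ (by simp)))
      rw [hg l (by simp), this, ← g.map_fun] at hf
      exact (g.injective (Option.some_injective _ hf)).symm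

theorem IsLimit.unique {c : ℕ → ℕ → ℕ} {N N' : StructureSpace L} (h : S.IsLimit c N)
    (h' : S.IsLimit c N') : N = N' := by
  apply FirstOrder.Language.Structure.ext
  · funext n f x
    exact (h.2 n f x _).2 ((h'.2 n f x _).1 rfl)
  · funext n R x
    exact propext ((h.1 n R x).trans (h'.1 n R x).symm)

theorem IsLimit.comp_perm {c : ℕ → ℕ → ℕ} {N : StructureSpace L} (h : S.IsLimit c N)
    (g : Equiv.Perm ℕ) : S.IsLimit (c ∘ g) (logicAction L g.symm N) :=
  ⟨fun n R x => h.1 n R (g ∘ x), fun n f x l =>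
    (Equiv.symm_apply_eq g).trans (h.2 n f (g ∘ x) (g l))⟩

variable (S)

theorem measurableSet_eventuallyRel [Countable M] {n : ℕ} (R : L.Relations n) (x : Fin n → ℕ) :
    MeasurableSet {c | S.EventuallyRel c R x} := by
  let : MeasurableSpace (Option M) := ⊤
  have : DiscreteMeasurableSpace (Option M) := ⟨fun _ => trivial⟩
  refine measurableSet_eventually_nat fun k => ?_
  have hm : Measurable fun (c : ℕ → ℕ → ℕ) (i : Fin n) => S.path (c (x i)) k :=
    measurable_pi_iff.2 fun i => (S.measurable_path k).comp (measurable_pi_apply (x i))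
  exact hm (.of_discrete (s := {z : Fin n → Option M | ∃ a : Fin n → M, (∀ i, z i = some (a i)) ∧
    Language.Structure.RelMap R a}))

theorem measurableSet_eventuallyFun [Countable M] {n : ℕ} (f : L.Functions n) (x : Fin n → ℕ)
    (l : ℕ) : MeasurableSet {c | S.EventuallyFun c f x l} := by
  let : MeasurableSpace (Option M) := ⊤
  have : DiscreteMeasurableSpace (Option M) := ⟨fun _ => trivial⟩
  refine measurableSet_eventually_nat fun k => ?_
  have hm : Measurable fun (c : ℕ → ℕ → ℕ) =>
      ((fun i : Fin n => S.path (c (x i)) k), S.path (c l) k) :=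
    (measurable_pi_iff.2 fun i => (S.measurable_path k).comp (measurable_pi_apply (x i))).prodMk
      ((S.measurable_path k).comp (measurable_pi_apply l))
  exact hm (.of_discrete (s := {z : (Fin n → Option M) × Option M | ∃ a : Fin n → M,
    (∀ i, z.1 i = some (a i)) ∧ z.2 = some (Language.Structure.funMap f a)}))

theorem exists_measurable_limit [Countable M] {G : Set (ℕ → ℕ → ℕ)} (hG : MeasurableSet G)
    (hGc : ∀ c ∈ G, S.Generic c) (hne : G.Nonempty) :
    ∃ N : (ℕ → ℕ → ℕ) → StructureSpace L, Measurable N ∧ (∀ c, N c ∈ isoClass L M) ∧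
      ∀ c ∈ G, S.IsLimit c (N c) := by
  classical
  obtain ⟨c₀, hc₀⟩ := hne
  obtain ⟨h₀, -⟩ := (hGc c₀ hc₀).exists_isLimit
  -- Off `G` the fixed default `h₀` is used, so every value is a copy of `M` and measurability only
  -- has to be checked on `G`.
  have hch : ∀ c, ∃ h : ℕ ≃ M, (c ∈ G → S.IsLimit c (pullback L h)) ∧ (c ∉ G → h = h₀) := by
    intro c
    by_cases hc : c ∈ G
    · obtain ⟨h, hh⟩ := (hGc c hc).exists_isLimit
      exact ⟨h, fun _ => hh, fun h' => absurd hc h'⟩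
    · exact ⟨h₀, fun h' => absurd h' hc, fun _ => rfl⟩
  choose h hlim hdef using hch
  have hmeas : ∀ (A : Set (ℕ → ℕ → ℕ)) (Q : Set (StructureSpace L)), MeasurableSet A →
      (∀ c ∈ G, pullback L (h c) ∈ Q ↔ c ∈ A) →
      MeasurableSet ((fun c => pullback L (h c)) ⁻¹' Q) := by
    intro A Q hA hQ
    have e : (fun c => pullback L (h c)) ⁻¹' Q = G.ite A {_c | pullback L h₀ ∈ Q} := by
      ext c
      by_cases hc : c ∈ G
      · simpa [Set.ite, hc] using hQ c hc
      · simp [Set.ite, hc, hdef c hc]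
    rw [e]
    exact hG.ite hA (.const _)
  refine ⟨fun c => pullback L (h c), measurable_of_atoms (fun n R x => ?_) (fun n f x l => ?_),
    fun c => pullback_mem_isoClass _, hlim⟩
  · exact hmeas _ _ (S.measurableSet_eventuallyRel R x) fun c hc => (hlim c hc).1 n R x
  · exact hmeas _ _ (S.measurableSet_eventuallyFun f x l) fun c hc => (hlim c hc).2 n f x l

end CloneSystem

/-- The measure is the law of the limit structure. Permuting the paths preserves their joint law
and, by uniqueness of limits, acts on the limit by relabelling. -/
theorem CloneSystem.exists_invariant_measure {L : FirstOrder.Language.{u, v}} {M : Type w}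
    [L.Structure M] [Countable M] (S : CloneSystem L M) : ∃ μ : Measure (StructureSpace L),
    IsProbabilityMeasure μ ∧ IsInvariant L μ ∧ μ (isoClass L M) = 1 := by
  obtain ⟨ν, _, hν⟩ := exists_fullSupport_measure_nat
  let P := Measure.infinitePi (fun _ : ℕ => Measure.infinitePi fun _ : ℕ => ν)
  have hae : ∀ᵐ c ∂P, S.Generic c := S.ae_generic ν hν
  obtain ⟨B, hB, hBm, hB0⟩ := exists_measurable_superset_of_null hae
  have hG : ∀ᵐ c ∂P, c ∈ Bᶜ := by simpa [ae_iff] using hB0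
  obtain ⟨N, hNm, hiso, hlim⟩ := S.exists_measurable_limit hBm.compl
    (fun c hc => by_contra fun h => hc (hB h)) hG.exists
  have hprob : IsProbabilityMeasure (P.map N) := Measure.isProbabilityMeasure_map hNm.aemeasurable
  refine ⟨P.map N, hprob, fun g X hX => ?_, le_antisymm prob_le_one ?_⟩
  · have hpres := measurePreserving_comp_perm (Measure.infinitePi fun _ : ℕ => ν) g
    have himg : logicAction L g '' X = logicAction L g.symm ⁻¹' X :=
      congrFun (Set.image_eq_preimage_of_inverse (logicAction_logicAction_symm g.symm)
        (logicAction_logicAction_symm g)) X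
    have heq : ∀ᵐ c ∂P, N (c ∘ g) = logicAction L g.symm (N c) := by
      filter_upwards [hG, hpres.quasiMeasurePreserving.ae hG] with c hc hc'
      exact (hlim _ hc').unique ((hlim _ hc).comp_perm g)
    rw [himg, Measure.map_apply hNm hX, Measure.map_apply hNm (measurable_logicAction _ hX),
      ← hpres.measure_preimage (hNm hX).nullMeasurableSet]
    refine measure_congr ?_
    filter_upwards [heq] with c hc
    exact congrArg (· ∈ X) hc
  -- Every value of `N` is a copy of `M`, and the inequality for image measures holds for arbitrary
  -- sets, so measurability of the isomorphism class is not needed.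
  · calc 1 = P (N ⁻¹' isoClass L M) := by
          rw [Set.eq_univ_of_forall (s := N ⁻¹' isoClass L M) hiso, measure_univ]
      _ ≤ _ := Measure.le_map_apply hNm.aemeasurable _

end InvariantMeasures

theorem theorem1p1 (L : FirstOrder.Language.{u, v}) [Countable L.Symbols]
    (M : Type w) [L.Structure M] [Countable M] [Infinite M] :
    (∃ μ : MeasureTheory.Measure (InvariantMeasures.StructureSpace L),
        MeasureTheory.IsProbabilityMeasure μ ∧ InvariantMeasures.IsInvariant L μ ∧
          μ (InvariantMeasures.isoClass L M) = 1) ↔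
      ∀ (n : ℕ) (a : Fin n → M), InvariantMeasures.dcl L a = Set.range a := by
  constructor
  · rintro ⟨μ, _, hinv, hM⟩ n a
    refine (InvariantMeasures.dcl_subset_range_of_isInvariant μ hinv hM a).antisymm ?_
    rintro _ ⟨i, rfl⟩ g hg
    exact hg i
  · intro hM
    obtain ⟨S⟩ := InvariantMeasures.nonempty_cloneSystem hM
    exact S.exists_invariant_measure
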